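/- Let $K$ be a field of characteristic $0$ and let $K\langle x,y\rangle$ be the free associative $K$-algebra on $x,y$. The degree $\deg$ of a polynomial is the maximal length of a word occurring in it with nonzero coefficient, and $[f,g]=fg-gf$. Two elements $f,g$ of a free associative algebra over $K$ are called algebraically independent if $p(f,g)\neq 0$ for every nonzero $p\in K\langle t_1,t_2\rangle$, and algebraically dependent otherwise; $f$ generates its centralizer if $C(f)=\{h: hf=fh\}$ equals $K[f]$. For $k\ge 2$ let $$u=(xy)^kx,\quad v=xy,\quad w=yx,\quad f=u^3+uv+uw+wu,\quad g=u^2+v+w.$$ Then: 1. $f$ and $g$ are algebraically independent, and each of them generates its centralizer in $K\langle x,y\rangle$. 2. The homogeneous components of maximal degree of $f$ and $g$ are $u^3$ and $u^2$ respectively, and these are algebraically dependent. 3. $\deg f=6k+3$ and $\deg g=4k+2$, and neither of these degrees divides the other. 4. $[f,g]\ne 0$ and $\deg [f,g]=2k+5<\deg g<\deg f$. 5. $$\frac{\deg [f,g]}{\deg g}=\frac12+\frac{2}{2k+1}>\frac12,$$ and this quotient tends to $\frac12$ as $k\to\infty$. Consequently the following conjecture of J.-T. Yu is false for $K\langle x,y\rangle$: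 if $f,g$ are algebraically independent, their homogeneous components of maximal degree are algebraically dependent, $f$ and $g$ each generate their own centralizer, and neither of $\deg f,\deg g$ divides the other, then $\deg [f,g]>\min\{\deg f,\deg g\}$. -/

import Mathlib

open Filter Topology

namespace FreeAlg

noncomputable section

variable {K : Type*} [Field K] {X : Type*}

/-- The coefficient of the word `m` in the noncommutative polynomial `p`, as a finitely supported
function of `m`. -/
def coeffs (p : FreeAlgebra K X) : FreeMonoid X →₀ K :=
  (FreeAlgebra.equivMonoidAlgebraFreeMonoid p).coeff

/-- The degree of a noncommutative polynomial: the maximal length of a word that occurs in it with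
a nonzero coefficient (with the convention that the degree of `0` is `0`). -/
def deg (p : FreeAlgebra K X) : ℕ :=
  (coeffs p).support.sup FreeMonoid.length

/-- The homogeneous component of degree `n`: the part of `p` that is supported on words of
length `n`. -/
def homComponent (n : ℕ) (p : FreeAlgebra K X) : FreeAlgebra K X :=
  FreeAlgebra.equivMonoidAlgebraFreeMonoid.symm
    (MonoidAlgebra.ofCoeff ((coeffs p).filter fun m => m.length = n))

/-- The homogeneous component of maximal degree. -/
def leading (p : FreeAlgebra K X) : FreeAlgebra K X :=
  homComponent (deg p) p

/-- `f` and `g` are algebraically independent: no nonzero noncommutative polynomial in two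
variables vanishes at `(f, g)`. -/
def AlgIndep (f g : FreeAlgebra K X) : Prop :=
  ∀ p : FreeAlgebra K (Fin 2), FreeAlgebra.lift K ![f, g] p = 0 → p = 0

/-- `f` and `g` are algebraically dependent. -/
def AlgDep (f g : FreeAlgebra K X) : Prop :=
  ¬ AlgIndep f g

/-- `f` generates its centralizer: `C(f) = K[f]`. -/
def GeneratesCentralizer (f : FreeAlgebra K X) : Prop :=
  Subalgebra.centralizer K {f} = Algebra.adjoin K {f}

/-- The commutator `[f, g] = f g - g f`. -/
def comm (f g : FreeAlgebra K X) : FreeAlgebra K X :=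
  f * g - g * f

/-- Yu's conjecture for the free associative algebra over `K` in the variables `X`. -/
def YuConjecture (K : Type*) [Field K] (X : Type*) : Prop :=
  ∀ f g : FreeAlgebra K X,
    AlgIndep f g →
    AlgDep (leading f) (leading g) →
    GeneratesCentralizer f →
    GeneratesCentralizer g →
    ¬ deg f ∣ deg g →
    ¬ deg g ∣ deg f →
    min (deg f) (deg g) < deg (comm f g)

variable (K)

/-- The variable `x` of `K⟨x, y⟩`. -/
def x : FreeAlgebra K (Fin 2) := FreeAlgebra.ι K 0

/-- The variable `y` of `K⟨x, y⟩`. -/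
def y : FreeAlgebra K (Fin 2) := FreeAlgebra.ι K 1

/-- `u = (xy)^k x`. -/
def u (k : ℕ) : FreeAlgebra K (Fin 2) := (x K * y K) ^ k * x K

/-- `v = xy`. -/
def v : FreeAlgebra K (Fin 2) := x K * y K

/-- `w = yx`. -/
def w : FreeAlgebra K (Fin 2) := y K * x K

/-- `f = u³ + uv + uw + wu`. -/
def f (k : ℕ) : FreeAlgebra K (Fin 2) :=
  u K k ^ 3 + (u K k * v K + u K k * w K + w K * u K k)

/-- `g = u² + v + w`. -/
def g (k : ℕ) : FreeAlgebra K (Fin 2) :=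
  u K k ^ 2 + (v K + w K)

end

end FreeAlg

/-!
Since `v u = u w`, all terms of high degree in `[f, g]` cancel, and
`[f, g] = u v² + u v w - v w u - w² u` holds exactly (`comm_f_g`). Degrees and leading parts are read
off from the homomorphism `grade : K⟨X⟩ → K⟨X⟩[t]` that multiplies each letter by a central
variable `t`.

Algebraic independence (`algIndep_f_g`) only needs that `f` and `g` are linearly independent from
the right over the free algebra; splitting `f p + g q = 0` by the first letter shows this.

The centralizers are computed by `generatesCentralizer_of_family`. If `r` commutes with `a`, where
`a = g` (`s = 2`) or `a = f` (`s = 3`), then its leading part commutes with the word `uˢ` and hence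
is a multiple of a power of `u` (`homogeneous_of_commute`). Powers of `uˢ` are removed by powers of
`a`. The remaining powers are also leading parts, of `u` and `f gⁿ` for `a = g`, and of `u`, `g fⁿ`
and `g² fⁿ` for `a = f`, so what has to be excluded is a nontrivial combination of these, corrected
by terms of lower degree, that commutes with `a`. The commutators of these elements with `a` have
leading parts in different degrees, and the top one of them would have to be a commutator with
`uˢ`. For the commutator `[u, a]` the degree is too small for this. For the others, a representation
by `2 × 2` matrices that sends `uˢ` to the identity kills all commutators with `uˢ` but not that
leading part (`exists_algHom_u_sq`, `exists_algHom_u_cube`).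
-/

namespace FreeAlg

/-! ### Words, coefficients and the grading by length -/

section Grading

variable {K : Type*} [Field K] {X : Type*}

theorem coeffs_injective : Function.Injective (coeffs : FreeAlgebra K X → FreeMonoid X →₀ K) :=
  MonoidAlgebra.coeff_injective.comp FreeAlgebra.equivMonoidAlgebraFreeMonoid.injective

theorem coeffs_add (p q : FreeAlgebra K X) : coeffs (p + q) = coeffs p + coeffs q := by
  simp [coeffs]

theorem coeffs_smul (c : K) (p : FreeAlgebra K X) : coeffs (c • p) = c • coeffs p := by
  simp [coeffs]

theorem coeffs_zero : coeffs (0 : FreeAlgebra K X) = 0 := by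
  simp [coeffs]

/-- The word `m`, viewed as a noncommutative polynomial. -/
noncomputable def word (K : Type*) [Field K] {X : Type*} : FreeMonoid X →* FreeAlgebra K X :=
  FreeMonoid.lift (FreeAlgebra.ι K)

theorem word_of (i : X) : word K (FreeMonoid.of i) = FreeAlgebra.ι K i := by
  simp [word]

theorem equiv_word (m : FreeMonoid X) :
    FreeAlgebra.equivMonoidAlgebraFreeMonoid (word K m) = MonoidAlgebra.single m 1 := by
  induction m using FreeMonoid.inductionOn' with
  | one => simp [MonoidAlgebra.one_def]
  | of_mul i m ih =>
    rw [map_mul, map_mul, ih, word_of]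
    simp [FreeAlgebra.equivMonoidAlgebraFreeMonoid, MonoidAlgebra.single_mul_single]

theorem coeffs_word (m : FreeMonoid X) : coeffs (word K m) = Finsupp.single m 1 := by
  simp [coeffs, equiv_word]

theorem coeffs_mul_word (p : FreeAlgebra K X) (m n : FreeMonoid X) :
    coeffs (p * word K m) (n * m) = coeffs p n := by
  rw [coeffs, map_mul FreeAlgebra.equivMonoidAlgebraFreeMonoid, equiv_word,
    MonoidAlgebra.coeff_mul_single_eq_coeff_mul n]
  · simp [coeffs]
  · simp

theorem coeffs_word_mul (p : FreeAlgebra K X) (m n : FreeMonoid X) :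
    coeffs (word K m * p) (m * n) = coeffs p n := by
  rw [coeffs, map_mul FreeAlgebra.equivMonoidAlgebraFreeMonoid, equiv_word,
    MonoidAlgebra.coeff_single_mul_eq_mul_coeff n]
  · simp [coeffs]
  · simp

theorem coeffs_word_mul_of_ne (p : FreeAlgebra K X) {m n : FreeMonoid X}
    (h : ∀ d, m * d ≠ n) : coeffs (word K m * p) n = 0 := by
  rw [coeffs, map_mul FreeAlgebra.equivMonoidAlgebraFreeMonoid, equiv_word,
    MonoidAlgebra.coeff_single_mul_of_forall_mul_ne _ _ h]

/-- Every noncommutative polynomial is a linear combination of words. -/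
theorem induction_word {P : FreeAlgebra K X → Prop} (zero : P 0)
    (add : ∀ p q, P p → P q → P (p + q)) (smul : ∀ (c : K) m, P (c • word K m)) (p) : P p := by
  obtain ⟨q, rfl⟩ := FreeAlgebra.equivMonoidAlgebraFreeMonoid.symm.surjective p
  induction q using MonoidAlgebra.induction_linear with
  | zero => simpa using zero
  | add p q hp hq => simpa using add _ _ hp hq
  | single m c =>
    convert smul c m
    rw [AlgEquiv.symm_apply_eq, map_smul, equiv_word]
    simp

theorem coeffs_homComponent (n : ℕ) (p : FreeAlgebra K X) :
    coeffs (homComponent n p) = (coeffs p).filter fun m => m.length = n := by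
  simp [coeffs, homComponent]

theorem homComponent_add (n : ℕ) (p q : FreeAlgebra K X) :
    homComponent n (p + q) = homComponent n p + homComponent n q := by
  apply coeffs_injective
  simp [coeffs_add, coeffs_homComponent, Finsupp.filter_add]

/-- The homomorphism `K⟨X⟩ → K⟨X⟩[t]` that multiplies each letter by the central variable `t`: the
coefficient of `tⁿ` in the image of `p` is the homogeneous component of `p` of degree `n`. -/
noncomputable def grade : FreeAlgebra K X →ₐ[K] Polynomial (FreeAlgebra K X) :=
  FreeAlgebra.lift K fun i => Polynomial.C (FreeAlgebra.ι K i) * Polynomial.X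

theorem grade_ι (i : X) :
    grade (FreeAlgebra.ι K i) = Polynomial.monomial 1 (FreeAlgebra.ι K i) := by
  simp [grade, Polynomial.C_mul_X_eq_monomial]

theorem grade_word (m : FreeMonoid X) :
    grade (word K m) = Polynomial.monomial m.length (word K m) := by
  induction m using FreeMonoid.inductionOn' with
  | one => simp
  | of_mul i m ih =>
    rw [map_mul, map_mul, ih, word_of, grade_ι, Polynomial.monomial_mul_monomial,
      FreeMonoid.length_mul, FreeMonoid.length_of]

theorem coeff_grade (n : ℕ) (p : FreeAlgebra K X) :
    (grade p).coeff n = homComponent n p := by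
  induction p using induction_word with
  | zero =>
    apply coeffs_injective
    ext m
    simp [coeffs_homComponent, coeffs_zero, Finsupp.filter_apply]
  | add p q hp hq => simp [hp, hq, homComponent_add]
  | smul c m =>
    apply coeffs_injective
    rw [map_smul, grade_word, Polynomial.coeff_smul, Polynomial.coeff_monomial,
      coeffs_homComponent, coeffs_smul, coeffs_smul, coeffs_word]
    ext m'
    by_cases hm : m = m' <;> by_cases h : m.length = n <;>
      simp_all [coeffs_word, coeffs_zero]

theorem length_of_coeffs_coeff_grade_ne_zero {n : ℕ} {p : FreeAlgebra K X} {m : FreeMonoid X}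
    (h : coeffs ((grade p).coeff n) m ≠ 0) : m.length = n := by
  rw [coeff_grade, coeffs_homComponent] at h
  by_contra hm
  exact h (Finsupp.filter_apply_neg _ _ hm)

theorem grade_injective : Function.Injective (grade : FreeAlgebra K X → _) := by
  intro p q h
  apply coeffs_injective
  ext m
  have := congrArg (fun r => coeffs (r.coeff m.length) m) h
  simpa [coeff_grade, coeffs_homComponent, Finsupp.filter_apply] using this

/-- `HasTop p n q`: all words of `p` have length at most `n`, and `q` is the part of `p` of
degree exactly `n` (which may vanish). -/
structure HasTop (p : FreeAlgebra K X) (n : ℕ) (q : FreeAlgebra K X) : Prop where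
  natDegree_le : (grade p).natDegree ≤ n
  coeff_eq : (grade p).coeff n = q

theorem HasTop.coeff_of_lt {p q : FreeAlgebra K X} {n j : ℕ} (h : HasTop p n q) (hj : n < j) :
    (grade p).coeff j = 0 :=
  Polynomial.coeff_eq_zero_of_natDegree_lt (h.natDegree_le.trans_lt hj)

theorem HasTop.of_lt {p q : FreeAlgebra K X} {n j : ℕ} (h : HasTop p n q) (hj : n < j) :
    HasTop p j 0 :=
  ⟨h.natDegree_le.trans hj.le, h.coeff_of_lt hj⟩

theorem HasTop.congr {p q q' : FreeAlgebra K X} {n n' : ℕ} (h : HasTop p n q) (hn : n = n')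
    (hq : q = q') : HasTop p n' q' :=
  hn ▸ hq ▸ h

theorem HasTop.mul {p q p' q' : FreeAlgebra K X} {n n' : ℕ} (h : HasTop p n q)
    (h' : HasTop p' n' q') : HasTop (p * p') (n + n') (q * q') := by
  refine ⟨?_, ?_⟩
  · rw [map_mul]
    exact Polynomial.natDegree_mul_le_of_le h.natDegree_le h'.natDegree_le
  · rw [map_mul, Polynomial.coeff_mul_add_eq_of_natDegree_le h.natDegree_le h'.natDegree_le,
      h.coeff_eq, h'.coeff_eq]

theorem HasTop.pow {p q : FreeAlgebra K X} {n : ℕ} (h : HasTop p n q) (r : ℕ) :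
    HasTop (p ^ r) (r * n) (q ^ r) := by
  refine ⟨?_, ?_⟩
  · rw [map_pow]
    exact Polynomial.natDegree_pow_le_of_le r h.natDegree_le
  · rw [map_pow, Polynomial.coeff_pow_of_natDegree_le h.natDegree_le, h.coeff_eq]

theorem HasTop.add {p q p' q' : FreeAlgebra K X} {n : ℕ} (h : HasTop p n q)
    (h' : HasTop p' n q') : HasTop (p + p') n (q + q') := by
  refine ⟨?_, by simp [h.coeff_eq, h'.coeff_eq]⟩
  rw [map_add]
  exact Polynomial.natDegree_add_le_of_degree_le h.natDegree_le h'.natDegree_le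

theorem HasTop.sub {p q p' q' : FreeAlgebra K X} {n : ℕ} (h : HasTop p n q)
    (h' : HasTop p' n q') : HasTop (p - p') n (q - q') := by
  refine ⟨?_, by simp [h.coeff_eq, h'.coeff_eq]⟩
  rw [map_sub]
  exact (Polynomial.natDegree_sub_le_of_le h.natDegree_le h'.natDegree_le).trans (max_self n).le

theorem HasTop.smul {p q : FreeAlgebra K X} {n : ℕ} (h : HasTop p n q) (c : K) :
    HasTop (c • p) n (c • q) := by
  refine ⟨?_, by simp [h.coeff_eq]⟩
  rw [map_smul]
  exact (Polynomial.natDegree_smul_le _ _).trans h.natDegree_le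

theorem hasTop_ι (i : X) : HasTop (FreeAlgebra.ι K i) 1 (FreeAlgebra.ι K i) :=
  ⟨by rw [grade_ι]; exact Polynomial.natDegree_monomial_le _, by simp [grade_ι]⟩

theorem HasTop.deg_eq {p q : FreeAlgebra K X} {n : ℕ} (h : HasTop p n q) (hq : q ≠ 0) :
    deg p = n := by
  apply le_antisymm
  · refine Finset.sup_le fun m hm => ?_
    by_contra! hlt
    have h0 := h.coeff_of_lt hlt
    rw [coeff_grade] at h0
    have := congrArg (fun r => coeffs r m) h0
    rw [Finsupp.mem_support_iff] at hm
    simp [coeffs_homComponent, coeffs_zero, hm] at this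
  · obtain ⟨m, hm⟩ : ∃ m, coeffs q m ≠ 0 := by
      by_contra! h0
      exact hq (coeffs_injective (by ext m; simp [h0, coeffs_zero]))
    rw [← h.coeff_eq] at hm
    have hl := length_of_coeffs_coeff_grade_ne_zero hm
    rw [coeff_grade, coeffs_homComponent, Finsupp.filter_apply, if_pos hl] at hm
    rw [← hl]
    exact Finset.le_sup (f := FreeMonoid.length) (Finsupp.mem_support_iff.2 hm)

theorem HasTop.leading_eq {p q : FreeAlgebra K X} {n : ℕ} (h : HasTop p n q) (hq : q ≠ 0) :
    leading p = q := by
  rw [leading, h.deg_eq hq, ← coeff_grade, h.coeff_eq]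

end Grading

/-! ### A criterion for algebraic independence -/

section Independence

variable {K : Type*} [Field K]

theorem exists_eq_add_ι_mul (p : FreeAlgebra K (Fin 2)) :
    ∃ (c : K) (p₀ p₁ : FreeAlgebra K (Fin 2)),
      p = algebraMap K _ c + (FreeAlgebra.ι K 0 * p₀ + FreeAlgebra.ι K 1 * p₁) := by
  induction p using induction_word with
  | zero => exact ⟨0, 0, 0, by simp⟩
  | add p q hp hq =>
    obtain ⟨c, p₀, p₁, rfl⟩ := hp
    obtain ⟨d, q₀, q₁, rfl⟩ := hq
    exact ⟨c + d, p₀ + q₀, p₁ + q₁, by simp only [map_add, mul_add]; abel⟩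
  | smul c m =>
    cases m using FreeMonoid.casesOn with
    | one => exact ⟨c, 0, 0, by simp [Algebra.algebraMap_eq_smul_one]⟩
    | of_mul i m =>
      fin_cases i
      · exact ⟨0, c • word K m, 0, by simp [word_of]⟩
      · exact ⟨0, 0, c • word K m, by simp [word_of]⟩

theorem coeffs_ι_mul (i : Fin 2) (p : FreeAlgebra K (Fin 2)) (m : FreeMonoid (Fin 2)) :
    coeffs (FreeAlgebra.ι K i * p) (FreeMonoid.of i * m) = coeffs p m := by
  rw [← word_of, coeffs_word_mul]

theorem coeffs_ι_mul_of_ne {i j : Fin 2} (h : i ≠ j) (p : FreeAlgebra K (Fin 2))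
    (m : FreeMonoid (Fin 2)) :
    coeffs (FreeAlgebra.ι K i * p) (FreeMonoid.of j * m) = 0 := by
  rw [← word_of]
  refine coeffs_word_mul_of_ne _ fun d hd => h ?_
  exact (List.cons.inj hd).1

theorem ι_mul_add_ι_mul_eq_zero {p q : FreeAlgebra K (Fin 2)}
    (h : FreeAlgebra.ι K 0 * p + FreeAlgebra.ι K 1 * q = 0) : p = 0 ∧ q = 0 := by
  constructor <;> apply coeffs_injective <;> ext m
  · have := congrArg (fun r => coeffs r (FreeMonoid.of 0 * m)) h
    simpa [coeffs_add, coeffs_zero, coeffs_ι_mul, coeffs_ι_mul_of_ne] using this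
  · have := congrArg (fun r => coeffs r (FreeMonoid.of 1 * m)) h
    simpa [coeffs_add, coeffs_zero, coeffs_ι_mul, coeffs_ι_mul_of_ne] using this

/-- Two polynomials without constant term that are linearly independent over the free algebra from
the right are algebraically independent: a relation `p(a, b) = 0` with `p = c + t₁ p₁ + t₂ p₂` has
`c = 0`, and then `p₁` and `p₂` are relations too, so all coefficients of `p` vanish by induction on
the word. -/
theorem algIndep_of_right_independent {a b : FreeAlgebra K (Fin 2)}
    (ha : FreeAlgebra.algebraMapInv a = 0) (hb : FreeAlgebra.algebraMapInv b = 0)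
    (h : ∀ p q, a * p + b * q = 0 → p = 0 ∧ q = 0) : AlgIndep a b := by
  have key : ∀ (m : FreeMonoid (Fin 2)) (p : FreeAlgebra K (Fin 2)),
      FreeAlgebra.lift K ![a, b] p = 0 → coeffs p m = 0 := by
    intro m
    induction m using FreeMonoid.inductionOn' with
    | one =>
      intro p hp
      obtain ⟨c, p₀, p₁, rfl⟩ := exists_eq_add_ι_mul p
      have hc : c = 0 := by
        have := congrArg FreeAlgebra.algebraMapInv hp
        simpa [ha, hb, FreeAlgebra.algebraMap_leftInverse c] using this
      have hne : ∀ (i : Fin 2) (d : FreeMonoid (Fin 2)), FreeMonoid.of i * d ≠ 1 :=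
        fun i d hd => by simpa using congrArg FreeMonoid.length hd
      rw [hc, map_zero, zero_add, coeffs_add, ← word_of, ← word_of, Finsupp.add_apply,
        coeffs_word_mul_of_ne _ (hne 0), coeffs_word_mul_of_ne _ (hne 1), add_zero]
    | of_mul i m ih =>
      intro p hp
      obtain ⟨c, p₀, p₁, rfl⟩ := exists_eq_add_ι_mul p
      have hc : c = 0 := by
        have := congrArg FreeAlgebra.algebraMapInv hp
        simpa [ha, hb, FreeAlgebra.algebraMap_leftInverse c] using this
      subst hc
      obtain ⟨h₀, h₁⟩ := h _ _ (by simpa using hp)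
      rw [map_zero, zero_add, coeffs_add, Finsupp.add_apply]
      fin_cases i
      · simpa [coeffs_ι_mul, coeffs_ι_mul_of_ne] using ih _ h₀
      · simpa [coeffs_ι_mul, coeffs_ι_mul_of_ne] using ih _ h₁
  intro p hp
  apply coeffs_injective
  ext m
  rw [key m p hp, coeffs_zero, Finsupp.zero_apply]

end Independence

/-! ### The centralizer of a power of the word `(xy)ᵏx` -/

section WordCentralizer

variable {K : Type*} [Field K]

theorem exists_eq_mul_of_mul_eq_mul {X : Type*} {a b c d : FreeMonoid X}
    (h : a * b = c * d) (hl : a.length ≤ c.length) : ∃ e, c = a * e := by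
  have ha : a.toList <+: (c * d).toList := ⟨b.toList, h⟩
  obtain ⟨e, he⟩ := List.prefix_of_prefix_length_le ha ⟨d.toList, rfl⟩ hl
  exact ⟨FreeMonoid.ofList e, he.symm⟩

/-- All words of a polynomial that commutes with a nonempty word `U` commute with `U`. A word `m` of
it satisfies `m U = U m₁` for another one of its words, hence `m Uʲ = Uʲ mⱼ` for all `j`, so `m` is
a prefix of a power of `U` and thereby determined by its length; hence `m₁ = m`. -/
theorem commute_of_coeffs_ne_zero {X : Type*} {h : FreeAlgebra K X} {U : FreeMonoid X}
    (hU : U ≠ 1) (hc : h * word K U = word K U * h) {m : FreeMonoid X} (hm : coeffs h m ≠ 0) :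
    m * U = U * m := by
  have step : ∀ m, coeffs h m ≠ 0 → ∃ m', coeffs h m' ≠ 0 ∧ m * U = U * m' := by
    intro m hm
    rw [← coeffs_mul_word h U m, hc] at hm
    obtain ⟨m', hm'⟩ : ∃ m', U * m' = m * U := by
      by_contra! hne
      exact hm (coeffs_word_mul_of_ne h hne)
    rw [← hm', coeffs_word_mul] at hm
    exact ⟨m', hm, hm'.symm⟩
  have iter : ∀ (j : ℕ) m, coeffs h m ≠ 0 → ∃ m', m * U ^ j = U ^ j * m' := by
    intro j
    induction j with
    | zero => exact fun m _ => ⟨m, by simp⟩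
    | succ j ih =>
      intro m hm
      obtain ⟨m₁, hm₁, e₁⟩ := step m hm
      obtain ⟨m₂, e₂⟩ := ih m₁ hm₁
      exact ⟨m₂, by rw [pow_succ', ← mul_assoc, e₁, mul_assoc, e₂, mul_assoc]⟩
  have hlen : ∀ j : ℕ, j ≤ (U ^ j).length := by
    intro j
    induction j with
    | zero => simp
    | succ j ih =>
      have : U.length ≠ 0 := fun h0 => hU (FreeMonoid.length_eq_zero.1 h0)
      rw [pow_succ, FreeMonoid.length_mul]
      omega
  obtain ⟨m₁, hm₁, e₁⟩ := step m hm
  have hl : m.length = m₁.length := by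
    have := congrArg FreeMonoid.length e₁
    simp only [FreeMonoid.length_mul] at this
    omega
  obtain ⟨n, en⟩ := iter m.length m hm
  obtain ⟨n₁, en₁⟩ := iter m.length m₁ hm₁
  obtain ⟨r, hr⟩ := exists_eq_mul_of_mul_eq_mul en (hlen _)
  obtain ⟨r₁, hr₁⟩ := exists_eq_mul_of_mul_eq_mul en₁ (hl ▸ hlen _)
  have : m = m₁ := (List.append_inj (hr.symm.trans hr₁ : m.toList ++ r.toList = _) hl).1
  rw [e₁, ← this]

/-- The word `(xy)ᵏx`. -/
def uWord (k : ℕ) : FreeMonoid (Fin 2) :=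
  (FreeMonoid.of 0 * FreeMonoid.of 1) ^ k * FreeMonoid.of 0

theorem word_uWord (k : ℕ) : word K (uWord k) = u K k := by
  simp [uWord, u, x, y, word_of]

theorem uWord_succ (k : ℕ) :
    (uWord (k + 1)).toList = 0 :: 1 :: (uWord k).toList := by
  rw [uWord, pow_succ', mul_assoc, mul_assoc]
  rfl

theorem length_uWord (k : ℕ) : (uWord k).length = 2 * k + 1 := by
  induction k with
  | zero => rfl
  | succ k ih =>
    rw [FreeMonoid.length, uWord_succ, List.length_cons, List.length_cons]
    rw [FreeMonoid.length] at ih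
    omega

theorem uWord_getElem? (k i : ℕ) (hi : i ≤ 2 * k) :
    (uWord k).toList[i]? = some (if Even i then 0 else 1) := by
  induction k generalizing i with
  | zero =>
    obtain rfl : i = 0 := by omega
    rfl
  | succ k ih =>
    rw [uWord_succ]
    match i with
    | 0 => simp
    | 1 => simp
    | i + 2 =>
      rw [List.getElem?_cons_succ, List.getElem?_cons_succ, ih i (by omega)]
      simp [Nat.even_add]

/-- The words that commute with `uˢ`, `u = (xy)ᵏx`, are the powers of `u`. Powers of `u` can be
split off, and no word of length `0 < d ≤ 2k` commutes with `uˢ`: the two letters of `uˢ` at `d - 1` and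
`d` would both be `x`. -/
theorem exists_eq_uWord_pow {k s : ℕ} {m : FreeMonoid (Fin 2)}
    (h : m * uWord k ^ (s + 2) = uWord k ^ (s + 2) * m) : ∃ j, m = uWord k ^ j := by
  induction hn : m.length using Nat.strong_induction_on generalizing m with
  | _ n ih =>
  rcases Nat.eq_zero_or_pos n with h0 | hpos
  · exact ⟨0, FreeMonoid.length_eq_zero.1 (hn.trans h0)⟩
  rcases le_or_gt (2 * k + 1) n with hle | hlt
  · obtain ⟨m', rfl⟩ : ∃ m', m = uWord k * m' := by
      refine exists_eq_mul_of_mul_eq_mul (b := uWord k ^ (s + 1) * m)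
        (d := uWord k ^ (s + 2)) ?_ (by rw [length_uWord]; omega)
      rw [h, ← mul_assoc, ← pow_succ']
    rw [FreeMonoid.length_mul, length_uWord] at hn
    obtain ⟨j, rfl⟩ := ih _ (by omega : m'.length < n) (by
      apply mul_left_cancel (a := uWord k)
      rw [← mul_assoc, h, ← mul_assoc, ← mul_assoc, ← pow_succ, ← pow_succ']) rfl
    exact ⟨j + 1, (pow_succ' _ _).symm⟩
  · exfalso
    have hl : (uWord k).toList.length = 2 * k + 1 := length_uWord k
    change m.toList.length = n at hn
    have e : m.toList ++ ((uWord k).toList ++ (uWord k ^ (s + 1)).toList) =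
        (uWord k).toList ++ ((uWord k).toList ++ (uWord k ^ s * m).toList) := by
      rw [pow_succ' _ (s + 1)] at h
      nth_rw 2 [pow_succ'] at h
      rw [mul_assoc, mul_assoc] at h
      exact h
    have e₁ := congrArg (fun l => l[n]?) e
    have e₂ := congrArg (fun l => l[n + 2 * k]?) e
    rw [List.getElem?_append_right (by omega), List.getElem?_append_left (by omega),
      List.getElem?_append_left (by omega), uWord_getElem? _ _ (by omega),
      uWord_getElem? _ _ (by omega)] at e₁
    rw [List.getElem?_append_right (by omega), List.getElem?_append_left (by omega),
      List.getElem?_append_right (by omega), List.getElem?_append_left (by omega),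
      uWord_getElem? _ _ (by omega), uWord_getElem? _ _ (by omega)] at e₂
    have h₁ : Even n := by
      by_contra hne
      simp [hne, hn] at e₁
    have h₂ : Even (n - 1) := by
      by_contra hne
      have : n + 2 * k - (uWord k).toList.length = n - 1 := by omega
      rw [this, hn, Nat.add_sub_cancel_left] at e₂
      simp [hne] at e₂
    rw [Nat.even_sub hpos] at h₂
    simp [h₁] at h₂

/-- A homogeneous polynomial that commutes with `uˢ` is a scalar multiple of a power of `u`. -/
theorem homogeneous_of_commute {k s n : ℕ} {h r : FreeAlgebra K (Fin 2)}
    (hr : (grade r).coeff n = h) (hc : h * u K k ^ (s + 2) = u K k ^ (s + 2) * h) :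
    h = 0 ∨ ∃ (c : K) (j : ℕ), n = j * (2 * k + 1) ∧ h = c • u K k ^ j := by
  have hpow : ∀ m, coeffs h m ≠ 0 → ∃ j, m = uWord k ^ j ∧ n = j * (2 * k + 1) := by
    intro m hm
    have hU : uWord k ^ (s + 2) ≠ 1 := by
      intro h1
      rw [pow_succ] at h1
      have := congrArg FreeMonoid.length h1
      rw [FreeMonoid.length_mul, length_uWord, FreeMonoid.length_one] at this
      omega
    obtain ⟨j, rfl⟩ := exists_eq_uWord_pow
      (commute_of_coeffs_ne_zero hU (by simpa [word_uWord] using hc) hm)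
    refine ⟨j, rfl, ?_⟩
    rw [← hr] at hm
    rw [← length_of_coeffs_coeff_grade_ne_zero hm]
    clear hm
    induction j with
    | zero => simp
    | succ j ih => rw [pow_succ, FreeMonoid.length_mul, ih, length_uWord]; ring
  by_cases h0 : h = 0
  · exact Or.inl h0
  right
  obtain ⟨m, hm⟩ : ∃ m, coeffs h m ≠ 0 := by
    by_contra! h1
    exact h0 (coeffs_injective (by ext m; simp [h1, coeffs_zero]))
  obtain ⟨j, rfl, hj⟩ := hpow m hm
  refine ⟨coeffs h (uWord k ^ j), j, hj, coeffs_injective ?_⟩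
  ext m
  rw [← word_uWord, ← map_pow, coeffs_smul, coeffs_word, Finsupp.smul_single, smul_eq_mul, mul_one]
  by_cases hmj : m = uWord k ^ j
  · simp [hmj]
  · rw [Finsupp.single_eq_of_ne hmj]
    by_contra hne
    obtain ⟨i, rfl, hi⟩ := hpow m hne
    exact hmj (by rw [Nat.eq_of_mul_eq_mul_right (by omega) (hi.symm.trans hj)])

end WordCentralizer

/-! ### A criterion for generating the centralizer -/

section Criterion

variable {K : Type*} [Field K]

theorem coeff_grade_sum_of_lt {ι : Type*} {E L : ι → FreeAlgebra K (Fin 2)} {D : ι → ℕ}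
    (hE : ∀ i, HasTop (E i) (D i) (L i)) (c : ι →₀ K) {N : ℕ} (hN : ∀ i ∈ c.support, D i < N) :
    (grade (Finsupp.linearCombination K E c)).coeff N = 0 := by
  rw [Finsupp.linearCombination_apply, Finsupp.sum, map_sum, Polynomial.finsetSum_coeff]
  refine Finset.sum_eq_zero fun i hi => ?_
  rw [map_smul, Polynomial.coeff_smul, (hE i).coeff_of_lt (hN i hi), smul_zero]

theorem coeff_grade_sum_of_max {ι : Type*} {E L : ι → FreeAlgebra K (Fin 2)} {D : ι → ℕ}
    (hE : ∀ i, HasTop (E i) (D i) (L i)) (hD : Function.Injective D) (c : ι →₀ K) {i₀ : ι}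
    (h₀ : i₀ ∈ c.support) (hmax : ∀ i ∈ c.support, D i ≤ D i₀) :
    (grade (Finsupp.linearCombination K E c)).coeff (D i₀) = c i₀ • L i₀ := by
  rw [Finsupp.linearCombination_apply, Finsupp.sum, map_sum, Polynomial.finsetSum_coeff,
    Finset.sum_eq_single_of_mem i₀ h₀]
  · rw [map_smul, Polynomial.coeff_smul, (hE i₀).coeff_eq]
  · intro i hi hne
    have : D i < D i₀ := lt_of_le_of_ne (hmax i hi) (hD.ne hne)
    rw [map_smul, Polynomial.coeff_smul, (hE i).coeff_of_lt this, smul_zero]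

/-- Let `a` have leading part `uˢ`, and let `bᵢ` be polynomials whose leading parts are the powers
of `u` that are not powers of `uˢ`. If the commutators `[bᵢ, a]` have leading parts in pairwise
different degrees and none of these leading parts is of the form `[p, uˢ]`, then the centralizer of
`a` is `K[a]`.

By induction on the degree of `r`, a relation `[r, a] = ∑ cᵢ [bᵢ, a]` implies
`r - ∑ cᵢ bᵢ ∈ K[a]`. If the right hand side has large degree, then its leading part, a multiple of
that of some `[bᵢ, a]`, is a commutator with `uˢ`, which is excluded; otherwise the leading
part of `r` commutes with `uˢ`, and subtracting from `r` a multiple of a power of `a` or of some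
`bᵢ` lowers the degree. -/
theorem generatesCentralizer_of_family {ι : Type*} {k s : ℕ} {a : FreeAlgebra K (Fin 2)}
    (ha : HasTop a ((s + 2) * (2 * k + 1)) (u K k ^ (s + 2)))
    (b L : ι → FreeAlgebra K (Fin 2)) (e D : ι → ℕ)
    (hb : ∀ i, HasTop (b i) (e i * (2 * k + 1)) (u K k ^ e i))
    (he : ∀ j, s + 2 ∣ j ∨ ∃ i, e i = j)
    (hE : ∀ i, HasTop (comm (b i) a) (D i) (L i)) (hD : Function.Injective D)
    (hL : ∀ i, L i ≠ 0)
    (hcomm : ∀ i, (s + 2) * (2 * k + 1) ≤ D i → ∀ p, comm p (u K k ^ (s + 2)) ≠ L i) :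
    GeneratesCentralizer a := by
  have key : ∀ (n : ℕ) (r : FreeAlgebra K (Fin 2)) (c : ι →₀ K),
      (∀ j, n ≤ j → (grade r).coeff j = 0) →
      comm r a = Finsupp.linearCombination K (fun i => comm (b i) a) c →
      r - Finsupp.linearCombination K b c ∈ Algebra.adjoin K {a} := by
    intro n
    induction n with
    | zero =>
      intro r c hr h
      have hr0 : r = 0 := grade_injective (by ext1 j; simp [hr j (Nat.zero_le j)])
      subst hr0
      rcases c.support.eq_empty_or_nonempty with h0 | hne
      · rw [Finsupp.support_eq_empty.1 h0]
        simp
      · obtain ⟨i₀, hi₀, hmax⟩ := c.support.exists_max_image D hne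
        have := coeff_grade_sum_of_max hE hD c hi₀ hmax
        rw [← h] at this
        simp only [comm, zero_mul, mul_zero, sub_zero, map_zero, Polynomial.coeff_zero] at this
        rw [eq_comm, smul_eq_zero] at this
        exact (this.elim (Finsupp.mem_support_iff.1 hi₀) (hL i₀)).elim
    | succ n ih =>
      intro r c hr h
      have htop : ∀ d, n ≤ d → HasTop r d ((grade r).coeff d) := fun d hd =>
        ⟨Polynomial.natDegree_le_iff_coeff_eq_zero.2 fun j hj => hr j (by omega), rfl⟩
      have hcoeff : ∀ d, n ≤ d → (grade (comm r a)).coeff (d + (s + 2) * (2 * k + 1)) =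
          comm ((grade r).coeff d) (u K k ^ (s + 2)) := by
        intro d hd
        refine (((htop d hd).mul ha).sub ?_).coeff_eq
        rw [add_comm]
        exact ha.mul (htop d hd)
      by_cases hbig : ∃ i ∈ c.support, n + (s + 2) * (2 * k + 1) ≤ D i
      · obtain ⟨i₁, hi₁, hle⟩ := hbig
        obtain ⟨i₀, hi₀, hmax⟩ := c.support.exists_max_image D ⟨i₁, hi₁⟩
        have hc := coeff_grade_sum_of_max hE hD c hi₀ hmax
        obtain ⟨d, hd⟩ := Nat.exists_eq_add_of_le (hle.trans (hmax i₁ hi₁))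
        rw [← h, hd, show n + (s + 2) * (2 * k + 1) + d = n + d + (s + 2) * (2 * k + 1) by ring,
          hcoeff _ (by omega)] at hc
        refine (hcomm i₀ (by omega) ((c i₀)⁻¹ • (grade r).coeff (n + d)) ?_).elim
        rw [comm] at hc
        rw [comm, smul_mul_assoc, mul_smul_comm, ← smul_sub, hc, smul_smul,
          inv_mul_cancel₀ (Finsupp.mem_support_iff.1 hi₀), one_smul]
      · push Not at hbig
        have h0 := hcoeff n le_rfl
        rw [h, coeff_grade_sum_of_lt hE c hbig, comm, eq_comm, sub_eq_zero] at h0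
        -- Subtracting `q` from `r` cancels the part of `r` of degree `n`.
        have lower : ∀ q, HasTop q n ((grade r).coeff n) →
            ∀ j, n ≤ j → (grade (r - q)).coeff j = 0 := by
          intro q hq j hj
          rcases hj.eq_or_lt with rfl | hlt
          · rw [((htop n le_rfl).sub hq).coeff_eq, sub_self]
          · exact ((htop n le_rfl).sub hq).coeff_of_lt hlt
        rcases homogeneous_of_commute rfl h0 with hz | ⟨t, j, hj, ht⟩
        · refine ih r c (fun j hj => ?_) h
          rcases hj.eq_or_lt with rfl | hlt
          · exact hz
          · exact hr j hlt
        rcases he j with ⟨q, rfl⟩ | ⟨i, rfl⟩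
        · have hq : HasTop (t • a ^ q) n ((grade r).coeff n) := by
            rw [ht, hj, pow_mul,
              show (s + 2) * q * (2 * k + 1) = q * ((s + 2) * (2 * k + 1)) by ring]
            exact (ha.pow q).smul t
          have hmem : t • a ^ q ∈ Algebra.adjoin K {a} :=
            Subalgebra.smul_mem _ (Subalgebra.pow_mem _ (Algebra.self_mem_adjoin_singleton K a) q) t
          have := ih (r - t • a ^ q) c (lower _ hq) (by
            rw [← h, comm, comm, sub_mul, mul_sub, smul_mul_assoc, mul_smul_comm, ← pow_succ,
              ← pow_succ']
            abel)
          convert add_mem this hmem using 1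
          abel
        · have hq : HasTop (t • b i) n ((grade r).coeff n) := by
            rw [ht, hj]
            exact (hb i).smul t
          have := ih (r - t • b i) (c - Finsupp.single i t) (lower _ hq) (by
            rw [map_sub, ← h, Finsupp.linearCombination_single]
            simp only [comm, sub_mul, mul_sub, smul_mul_assoc, mul_smul_comm, smul_sub]
            abel)
          convert this using 1
          rw [map_sub, Finsupp.linearCombination_single]
          abel
  apply le_antisymm
  · intro r hr
    rw [Subalgebra.mem_centralizer_iff] at hr
    have := key ((grade r).natDegree + 1) r 0
      (fun j hj => Polynomial.coeff_eq_zero_of_natDegree_lt hj)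
      (by rw [comm, hr a rfl, sub_self, map_zero])
    simpa using this
  · refine Algebra.adjoin_le ?_
    rintro _ rfl
    rw [SetLike.mem_coe, Subalgebra.mem_centralizer_iff]
    rintro _ rfl
    rfl

end Criterion

/-! ### Leading parts and the commutator of `f` and `g` -/

section Example

variable (K : Type*) [Field K]

theorem hasTop_v : HasTop (v K) 2 (v K) := (hasTop_ι 0).mul (hasTop_ι 1)

theorem hasTop_w : HasTop (w K) 2 (w K) := (hasTop_ι 1).mul (hasTop_ι 0)

theorem hasTop_u (k : ℕ) : HasTop (u K k) (2 * k + 1) (u K k) :=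
  (((hasTop_v K).pow k).mul (hasTop_ι 0)).congr (by ring) rfl

theorem hasTop_g {k : ℕ} (hk : 1 ≤ k) : HasTop (g K k) (2 * (2 * k + 1)) (u K k ^ 2) :=
  (((hasTop_u K k).pow 2).add (((hasTop_v K).add (hasTop_w K)).of_lt (by omega))).congr rfl
    (add_zero _)

theorem hasTop_f {k : ℕ} (hk : 1 ≤ k) : HasTop (f K k) (3 * (2 * k + 1)) (u K k ^ 3) := by
  have h₁ := (hasTop_u K k).mul (hasTop_v K)
  have h₂ := (hasTop_u K k).mul (hasTop_w K)
  have h₃ := ((hasTop_w K).mul (hasTop_u K k)).congr (add_comm _ _) rfl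
  exact (((hasTop_u K k).pow 3).add (((h₁.add h₂).add h₃).of_lt (by omega))).congr rfl
    (add_zero _)

theorem u_ne_zero (k : ℕ) : u K k ≠ 0 :=
  mul_ne_zero (pow_ne_zero _ (mul_ne_zero (FreeAlgebra.ι_ne_zero 0) (FreeAlgebra.ι_ne_zero 1)))
    (FreeAlgebra.ι_ne_zero 0)

theorem v_mul_u (k : ℕ) : v K * u K k = u K k * w K := by
  rw [u, v, w, ← mul_assoc, ← pow_succ', pow_succ]
  simp only [mul_assoc]

/-- The commutator of `f` and `g`, `u v² + u v w - v w u - w² u`. -/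
noncomputable def fgComm (k : ℕ) : FreeAlgebra K (Fin 2) :=
  u K k * v K * v K + u K k * v K * w K - v K * w K * u K k - w K * w K * u K k

theorem comm_f_g (k : ℕ) : comm (f K k) (g K k) = fgComm K k := by
  have h := v_mul_u K k
  have h' : ∀ z, v K * (u K k * z) = u K k * (w K * z) := fun z => by
    rw [← mul_assoc, h, mul_assoc]
  simp only [comm, f, g, fgComm, pow_succ, pow_zero, one_mul, mul_add, add_mul, mul_assoc, h']
  abel

theorem comm_u_g (k : ℕ) : comm (u K k) (g K k) = u K k * v K - w K * u K k := by
  simp only [comm, g, pow_succ, pow_zero, one_mul, mul_add, add_mul, mul_assoc, v_mul_u]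
  abel

theorem comm_u_f (k : ℕ) :
    comm (u K k) (f K k) = u K k * u K k * v K - w K * u K k * u K k := by
  simp only [comm, f, pow_succ, pow_zero, one_mul, mul_add, add_mul, mul_assoc, v_mul_u]
  abel

theorem hasTop_fgComm (k : ℕ) : HasTop (fgComm K k) (2 * k + 5) (fgComm K k) := by
  have hu := hasTop_u K k
  have hv := hasTop_v K
  have hw := hasTop_w K
  exact (((((hu.mul hv).mul hv).congr (by ring) rfl).add (((hu.mul hv).mul hw).congr (by ring)
    rfl)).sub (((hv.mul hw).mul hu).congr (by ring) rfl)).sub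
    (((hw.mul hw).mul hu).congr (by ring) rfl)

theorem comm_mul_pow (a b : FreeAlgebra K (Fin 2)) (n : ℕ) :
    comm (b * a ^ n) a = comm b a * a ^ n := by
  rw [comm, comm, sub_mul, mul_assoc, mul_assoc b, ← pow_succ, ← pow_succ', mul_assoc]

/-! ### Algebraic independence of `f` and `g` -/

/-- With `u = x u'`, one has `f = x (u' g) + y (x u)` and `g = x (u' u + y) + y x`, so that
`f p + g q = 0` forces `q = -u p` and then `u' v p = 0`. -/
theorem algIndep_f_g (k : ℕ) : AlgIndep (f K k) (g K k) := by
  have hu : u K k = x K * w K ^ k := by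
    rw [u, w, mul_pow_mul]
  have hux : ∀ z, u K k * z = x K * (w K ^ k * z) := fun z => by rw [hu, mul_assoc]
  have hx : FreeAlgebra.algebraMapInv (x K) = 0 := by simp [x, FreeAlgebra.algebraMapInv]
  have hy : FreeAlgebra.algebraMapInv (y K) = 0 := by simp [y, FreeAlgebra.algebraMapInv]
  have hx0 : x K ≠ 0 := FreeAlgebra.ι_ne_zero 0
  have hy0 : y K ≠ 0 := FreeAlgebra.ι_ne_zero 1
  refine algIndep_of_right_independent ?_ ?_ ?_
  · simp [f, u, v, w, hx, hy]
  · simp [g, u, v, w, hx, hy]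
  intro p q h
  have hf : f K k = x K * (w K ^ k * g K k) + y K * (x K * u K k) := by
    rw [f, pow_succ' _ 2, hux (u K k ^ 2), hux (v K), hux (w K), g]
    simp only [w, mul_add, mul_assoc, add_assoc]
  have hg : g K k = x K * (w K ^ k * u K k + y K) + y K * x K := by
    rw [g, pow_two, hux (u K k)]
    simp only [v, w, mul_add, add_assoc]
  obtain ⟨h₀, h₁⟩ : w K ^ k * g K k * p + (w K ^ k * u K k + y K) * q = 0 ∧
      x K * u K k * p + x K * q = 0 := by
    apply ι_mul_add_ι_mul_eq_zero
    change x K * _ + y K * _ = 0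
    rw [← h, congrArg (· * p) hf, congrArg (· * q) hg]
    simp only [mul_add, add_mul, mul_assoc]
    abel
  have hq : q = -(u K k * p) := by
    rw [mul_assoc, ← mul_add] at h₁
    exact eq_neg_of_add_eq_zero_right ((mul_eq_zero.1 h₁).resolve_left hx0)
  have hyu : y K * u K k = w K ^ k * w K := by
    rw [hu, ← mul_assoc, ← pow_succ, pow_succ', w]
  have hp : w K ^ k * v K * p = 0 := by
    rw [hq] at h₀
    have : w K ^ k * g K k * p + (w K ^ k * u K k + y K) * -(u K k * p) =
        w K ^ k * v K * p + (w K ^ k * w K - y K * u K k) * p := by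
      simp only [g, pow_two, mul_add, add_mul, sub_mul, mul_neg, mul_assoc]
      abel
    rwa [this, hyu, sub_self, zero_mul, add_zero] at h₀
  have hp0 : p = 0 := by
    have h0 : w K ^ k * v K ≠ 0 :=
      mul_ne_zero (pow_ne_zero _ (mul_ne_zero hy0 hx0)) (mul_ne_zero hx0 hy0)
    exact (mul_eq_zero.1 hp).resolve_left h0
  exact ⟨hp0, by rw [hq, hp0, mul_zero, neg_zero]⟩

/-! ### Representations in which a power of `u` is the identity -/

/-- Since `x = v⁻ᵏu` and `y = u⁻¹vᵏ⁺¹` as soon as `u` and `v` are invertible, these two can be sent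
to any pair of units of an algebra. -/
theorem exists_algHom {B : Type*} [Ring B] [Algebra K B] (k : ℕ) (U V : Bˣ) :
    ∃ φ : FreeAlgebra K (Fin 2) →ₐ[K] B,
      φ (u K k) = U ∧ φ (v K) = V ∧ φ (w K) = (U⁻¹ : Bˣ) * V * U := by
  have hv : (V ^ k)⁻¹ * U * (U⁻¹ * V ^ (k + 1)) = V := by
    rw [pow_succ]; group
  have hw : U⁻¹ * V ^ (k + 1) * ((V ^ k)⁻¹ * U) = U⁻¹ * V * U := by
    rw [pow_succ']; group
  let φ : FreeAlgebra K (Fin 2) →ₐ[K] B := FreeAlgebra.lift K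
    ![(((V ^ k)⁻¹ * U : Bˣ) : B), ((U⁻¹ * V ^ (k + 1) : Bˣ) : B)]
  have hφx : φ (x K) = (((V ^ k)⁻¹ * U : Bˣ) : B) := by simp [φ, x]
  have hφy : φ (y K) = ((U⁻¹ * V ^ (k + 1) : Bˣ) : B) := by simp [φ, y]
  have hφv : φ (v K) = V := by
    rw [v, map_mul, hφx, hφy, ← Units.val_mul, hv]
  refine ⟨φ, ?_, hφv, ?_⟩
  · change φ (v K ^ k * x K) = U
    rw [map_mul, map_pow, hφv, hφx, ← Units.val_pow_eq_pow_val, ← Units.val_mul,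
      mul_inv_cancel_left]
  · rw [w, map_mul, hφx, hφy, ← Units.val_mul, hw, Units.val_mul, Units.val_mul]

theorem comm_ne_of_algHom {B : Type*} [Ring B] [Algebra K B] {a q : FreeAlgebra K (Fin 2)}
    (φ : FreeAlgebra K (Fin 2) →ₐ[K] B) (ha : φ a = 1) (hq : φ q ≠ 0) (n : ℕ)
    (p : FreeAlgebra K (Fin 2)) : comm p a ≠ q * a ^ n := by
  intro h
  have := congrArg φ h
  rw [comm, map_sub, map_mul, map_mul, map_mul, map_pow, ha] at this
  exact hq (by simpa using this.symm)

variable [CharZero K]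

/-- The last element is `[u, f]`; there the representation only serves to show that it does not
vanish. -/
theorem exists_algHom_u_sq (k : ℕ) : ∃ φ : FreeAlgebra K (Fin 2) →ₐ[K] Matrix (Fin 2) (Fin 2) K,
    φ (u K k ^ 2) = 1 ∧ φ (fgComm K k) ≠ 0 ∧
      φ (u K k * u K k * v K - w K * u K k * u K k) ≠ 0 := by
  let U : (Matrix (Fin 2) (Fin 2) K)ˣ := ⟨!![0, 1; 1, 0], !![0, 1; 1, 0],
    by simp [Matrix.one_fin_two], by simp [Matrix.one_fin_two]⟩
  let V : (Matrix (Fin 2) (Fin 2) K)ˣ := ⟨!![1, 1; 0, 1], !![1, -1; 0, 1],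
    by simp [Matrix.one_fin_two], by simp [Matrix.one_fin_two]⟩
  obtain ⟨φ, hu, hv, hw⟩ := exists_algHom K k U V
  have hU : (U : Matrix (Fin 2) (Fin 2) K) = !![0, 1; 1, 0] := rfl
  have hU' : ((U⁻¹ : (Matrix (Fin 2) (Fin 2) K)ˣ) : Matrix (Fin 2) (Fin 2) K) =
    !![0, 1; 1, 0] := rfl
  have hV : (V : Matrix (Fin 2) (Fin 2) K) = !![1, 1; 0, 1] := rfl
  refine ⟨φ, ?_, fun h => ?_, fun h => ?_⟩
  · rw [map_pow, hu, hU, pow_two]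
    simp [Matrix.one_fin_two]
  · simp only [fgComm, map_sub, map_add, map_mul, hu, hv, hw, hU, hU', hV, Matrix.mul_fin_two] at h
    have := congrFun (congrFun h 1) 0
    norm_num at this
  · simp only [map_sub, map_mul, hu, hv, hw, hU, hU', hV, Matrix.mul_fin_two] at h
    have := congrFun (congrFun h 0) 1
    norm_num at this

/-- Of the three elements with nonzero image, the first two are, up to sign, the leading parts of
`[g, f]` and `[g², f]`, and the last one is `[u, g]`. -/
theorem exists_algHom_u_cube (k : ℕ) :
    ∃ φ : FreeAlgebra K (Fin 2) →ₐ[K] Matrix (Fin 2) (Fin 2) K,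
      φ (u K k ^ 3) = 1 ∧ φ (fgComm K k) ≠ 0 ∧
        φ (u K k ^ 2 * fgComm K k + fgComm K k * u K k ^ 2) ≠ 0 ∧
        φ (u K k * v K - w K * u K k) ≠ 0 := by
  let U : (Matrix (Fin 2) (Fin 2) K)ˣ := ⟨!![0, -1; 1, -1], !![-1, 1; -1, 0],
    by simp [Matrix.one_fin_two], by simp [Matrix.one_fin_two]⟩
  let V : (Matrix (Fin 2) (Fin 2) K)ˣ := ⟨!![1, 1; 0, 1], !![1, -1; 0, 1],
    by simp [Matrix.one_fin_two], by simp [Matrix.one_fin_two]⟩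
  obtain ⟨φ, hu, hv, hw⟩ := exists_algHom K k U V
  have hU : (U : Matrix (Fin 2) (Fin 2) K) = !![0, -1; 1, -1] := rfl
  have hU' : ((U⁻¹ : (Matrix (Fin 2) (Fin 2) K)ˣ) : Matrix (Fin 2) (Fin 2) K) =
    !![-1, 1; -1, 0] := rfl
  have hV : (V : Matrix (Fin 2) (Fin 2) K) = !![1, 1; 0, 1] := rfl
  refine ⟨φ, ?_, fun h => ?_, fun h => ?_, fun h => ?_⟩
  · rw [map_pow, hu, hU, pow_succ, pow_two]
    simp [Matrix.one_fin_two]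
  · simp only [fgComm, map_sub, map_add, map_mul, hu, hv, hw, hU, hU', hV, Matrix.mul_fin_two] at h
    have := congrFun (congrFun h 0) 0
    norm_num at this
  · simp only [fgComm, map_sub, map_add, map_mul, hu, hv, hw, hU, hU', hV, pow_two,
      Matrix.mul_fin_two] at h
    have := congrFun (congrFun h 0) 0
    norm_num [Matrix.mul_apply, Fin.sum_univ_two] at this
  · simp only [map_sub, map_mul, hu, hv, hw, hU, hU', hV, Matrix.mul_fin_two] at h
    have := congrFun (congrFun h 0) 0
    norm_num at this

theorem fgComm_ne_zero (k : ℕ) : fgComm K k ≠ 0 := by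
  obtain ⟨φ, -, h, -⟩ := exists_algHom_u_sq K k
  exact fun h0 => h (by rw [h0, map_zero])

/-! ### The centralizers of `f` and `g` -/

theorem generatesCentralizer_g {k : ℕ} (hk : 1 ≤ k) : GeneratesCentralizer (g K k) := by
  obtain ⟨φ, hφ, hC, -⟩ := exists_algHom_u_sq K k
  obtain ⟨ψ, -, -, -, h₁⟩ := exists_algHom_u_cube K k
  have hu := hasTop_u K k
  have hf := hasTop_f K hk
  have hg := hasTop_g K hk
  refine generatesCentralizer_of_family (k := k) (s := 0) hg
    (fun i : Option ℕ => i.elim (u K k) fun n => f K k * g K k ^ n)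
    (fun i => i.elim (u K k * v K - w K * u K k) fun n => fgComm K k * (u K k ^ 2) ^ n)
    (fun i => i.elim 1 fun n => 2 * n + 3)
    (fun i => i.elim (2 * k + 3) fun n => 2 * k + 5 + n * (2 * (2 * k + 1)))
    ?_ ?_ ?_ ?_ ?_ ?_
  · rintro (_ | n)
    · exact hu.congr (one_mul _).symm (pow_one _).symm
    · exact (hf.mul (hg.pow n)).congr (by simp only [Option.elim]; ring)
        (by rw [← pow_mul, ← pow_add, add_comm]; rfl)
  · intro j
    rcases Nat.even_or_odd' j with ⟨n, rfl | rfl⟩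
    · exact Or.inl ⟨n, by ring⟩
    · rcases n with _ | n
      · exact Or.inr ⟨none, rfl⟩
      · exact Or.inr ⟨some n, by simp only [Option.elim]; ring⟩
  · rintro (_ | n)
    · refine HasTop.congr (n := 2 * k + 3) (q := u K k * v K - w K * u K k) ?_ rfl rfl
      simp only [Option.elim, comm_u_g]
      exact (hu.mul (hasTop_v K)).sub (((hasTop_w K).mul hu).congr (by ring) rfl)
    · simp only [Option.elim, comm_mul_pow, comm_f_g]
      exact (hasTop_fgComm K k).mul (hg.pow n)
  · rintro (_ | n) (_ | m) h
    · rfl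
    · simp only [Option.elim] at h
      omega
    · simp only [Option.elim] at h
      omega
    · simp only [Option.elim] at h
      rw [Nat.eq_of_mul_eq_mul_right (by omega) (Nat.add_left_cancel h)]
  · rintro (_ | n)
    · exact fun h0 => h₁ ((congrArg ψ h0).trans (map_zero _))
    · refine fun h0 => comm_ne_of_algHom K φ hφ hC n 0 ?_
      simpa [comm] using h0.symm
  · rintro (_ | n) hle
    · simp only [Option.elim] at hle
      omega
    · exact comm_ne_of_algHom K φ hφ hC n

theorem generatesCentralizer_f {k : ℕ} (hk : 1 ≤ k) : GeneratesCentralizer (f K k) := by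
  obtain ⟨φ, hφ, hC, hC', -⟩ := exists_algHom_u_cube K k
  obtain ⟨ψ, -, -, h₁⟩ := exists_algHom_u_sq K k
  have hu := hasTop_u K k
  have hf := hasTop_f K hk
  have hg := hasTop_g K hk
  have hc := hasTop_fgComm K k
  have hgf : comm (g K k) (f K k) = -fgComm K k := by
    rw [← comm_f_g, comm, comm, neg_sub]
  have hggf : comm (g K k ^ 2) (f K k) = -(g K k * fgComm K k + fgComm K k * g K k) := by
    rw [← comm_f_g, comm, comm, pow_two]
    simp only [mul_sub, sub_mul, mul_assoc]
    abel
  have hn : ∀ {p q : FreeAlgebra K (Fin 2)} {n : ℕ}, HasTop p n q → HasTop (-p) n (-q) := by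
    intro p q n h
    simpa using h.smul (-1)
  have hC₁ : φ (-fgComm K k) ≠ 0 := by rwa [map_neg, neg_ne_zero]
  have hC₂ : φ (-(u K k ^ 2 * fgComm K k + fgComm K k * u K k ^ 2)) ≠ 0 := by
    rwa [map_neg, neg_ne_zero]
  refine generatesCentralizer_of_family (k := k) (s := 1) hf
    (fun i : Option (ℕ ⊕ ℕ) => i.elim (u K k) fun i =>
      i.elim (fun n => g K k * f K k ^ n) fun n => g K k ^ 2 * f K k ^ n)
    (fun i => i.elim (u K k * u K k * v K - w K * u K k * u K k) fun i =>
      i.elim (fun n => -fgComm K k * (u K k ^ 3) ^ n) fun n =>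
        -(u K k ^ 2 * fgComm K k + fgComm K k * u K k ^ 2) * (u K k ^ 3) ^ n)
    (fun i => i.elim 1 fun i => i.elim (fun n => 3 * n + 2) fun n => 3 * n + 4)
    (fun i => i.elim (4 * k + 4) fun i =>
      i.elim (fun n => 2 * k + 5 + n * (3 * (2 * k + 1))) fun n =>
        6 * k + 7 + n * (3 * (2 * k + 1)))
    ?_ ?_ ?_ ?_ ?_ ?_
  · rintro (_ | n | n)
    · exact hu.congr (one_mul _).symm (pow_one _).symm
    · exact (hg.mul (hf.pow n)).congr (by simp only [Option.elim, Sum.elim_inl]; ring)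
        (by rw [← pow_mul, ← pow_add, add_comm]; rfl)
    · exact ((hg.pow 2).mul (hf.pow n)).congr (by simp only [Option.elim, Sum.elim_inr]; ring)
        (by rw [← pow_mul, ← pow_mul, ← pow_add, add_comm]; rfl)
  · intro j
    obtain h | h | h : j % 3 = 0 ∨ j % 3 = 1 ∨ j % 3 = 2 := by omega
    · exact Or.inl (Nat.dvd_of_mod_eq_zero h)
    · right
      by_cases hj : j = 1
      · exact ⟨none, hj.symm⟩
      · exact ⟨some (.inr ((j - 4) / 3)), by simp only [Option.elim, Sum.elim_inr]; omega⟩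
    · exact Or.inr ⟨some (.inl (j / 3)), by simp only [Option.elim, Sum.elim_inl]; omega⟩
  · rintro (_ | n | n)
    · simp only [Option.elim, comm_u_f]
      exact (((hu.mul hu).mul (hasTop_v K)).congr (by ring) rfl).sub
        ((((hasTop_w K).mul hu).mul hu).congr (by ring) rfl)
    · simp only [Option.elim, Sum.elim_inl, comm_mul_pow, hgf]
      exact (hn hc).mul (hf.pow n)
    · simp only [Option.elim, Sum.elim_inr, comm_mul_pow, hggf]
      exact (hn (((hg.mul hc).congr (by ring) rfl).add ((hc.mul hg).congr (by ring) rfl))).mul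
        (hf.pow n)
  · -- The degrees `2k + 5` and `6k + 7` differ by `4k + 2`, which is not a multiple of `6k + 3`.
    have hne : ∀ n m : ℕ,
        2 * k + 5 + n * (3 * (2 * k + 1)) ≠ 6 * k + 7 + m * (3 * (2 * k + 1)) := by
      intro n m h
      rcases le_or_gt n m with hnm | hnm
      · have := Nat.mul_le_mul_right (3 * (2 * k + 1)) hnm
        omega
      · have := Nat.mul_le_mul_right (3 * (2 * k + 1)) hnm
        rw [Nat.succ_mul] at this
        omega
    have hne' : ∀ n : ℕ, 4 * k + 4 ≠ 2 * k + 5 + n * (3 * (2 * k + 1)) := by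
      rintro (_ | n) h
      · omega
      · rw [Nat.succ_mul n] at h
        omega
    rintro (_ | n | n) (_ | m | m) h <;>
      simp only [Option.elim, Sum.elim_inl, Sum.elim_inr] at h
    · rfl
    · exact (hne' m h).elim
    · omega
    · exact (hne' n h.symm).elim
    · rw [Nat.eq_of_mul_eq_mul_right (by omega) (Nat.add_left_cancel h)]
    · exact (hne n m h).elim
    · omega
    · exact (hne m n h.symm).elim
    · rw [Nat.eq_of_mul_eq_mul_right (by omega) (Nat.add_left_cancel h)]
  · rintro (_ | n | n)
    · exact fun h0 => h₁ ((congrArg ψ h0).trans (map_zero _))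
    · refine fun h0 => comm_ne_of_algHom K φ hφ hC₁ n 0 ?_
      exact (by simp [comm] : comm 0 (u K k ^ 3) = 0).trans h0.symm
    · refine fun h0 => comm_ne_of_algHom K φ hφ hC₂ n 0 ?_
      exact (by simp [comm] : comm 0 (u K k ^ 3) = 0).trans h0.symm
  · rintro (_ | n | n) hle
    · simp only [Option.elim] at hle
      omega
    · exact comm_ne_of_algHom K φ hφ hC₁ n
    · exact comm_ne_of_algHom K φ hφ hC₂ n

end Example

theorem algDep_pow {K : Type*} [Field K] (a : FreeAlgebra K (Fin 2)) (m n : ℕ) :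
    AlgDep (a ^ m) (a ^ n) := by
  intro h
  have h0 := h (FreeAlgebra.ι K 0 * FreeAlgebra.ι K 1 - FreeAlgebra.ι K 1 * FreeAlgebra.ι K 0)
    (by simp [← pow_add, add_comm])
  have := congrArg (fun p => coeffs p (FreeMonoid.of 0 * FreeMonoid.of 1)) (sub_eq_zero.1 h0)
  simp only [coeffs_ι_mul, coeffs_ι_mul_of_ne (i := (1 : Fin 2)) (j := 0) (by decide)] at this
  rw [← word_of, coeffs_word, Finsupp.single_eq_same] at this
  exact one_ne_zero this

end FreeAlg

theorem theorem3p1 (K : Type*) [Field K] [CharZero K] :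
    (∀ k : ℕ, 2 ≤ k →
      FreeAlg.AlgIndep (FreeAlg.f K k) (FreeAlg.g K k) ∧
      FreeAlg.GeneratesCentralizer (FreeAlg.f K k) ∧
      FreeAlg.GeneratesCentralizer (FreeAlg.g K k) ∧
      FreeAlg.leading (FreeAlg.f K k) = FreeAlg.u K k ^ 3 ∧
      FreeAlg.leading (FreeAlg.g K k) = FreeAlg.u K k ^ 2 ∧
      FreeAlg.AlgDep (FreeAlg.leading (FreeAlg.f K k)) (FreeAlg.leading (FreeAlg.g K k)) ∧
      FreeAlg.deg (FreeAlg.f K k) = 6 * k + 3 ∧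
      FreeAlg.deg (FreeAlg.g K k) = 4 * k + 2 ∧
      ¬ FreeAlg.deg (FreeAlg.f K k) ∣ FreeAlg.deg (FreeAlg.g K k) ∧
      ¬ FreeAlg.deg (FreeAlg.g K k) ∣ FreeAlg.deg (FreeAlg.f K k) ∧
      FreeAlg.comm (FreeAlg.f K k) (FreeAlg.g K k) ≠ 0 ∧
      FreeAlg.deg (FreeAlg.comm (FreeAlg.f K k) (FreeAlg.g K k)) = 2 * k + 5 ∧
      FreeAlg.deg (FreeAlg.comm (FreeAlg.f K k) (FreeAlg.g K k)) < FreeAlg.deg (FreeAlg.g K k) ∧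
      FreeAlg.deg (FreeAlg.g K k) < FreeAlg.deg (FreeAlg.f K k) ∧
      (FreeAlg.deg (FreeAlg.comm (FreeAlg.f K k) (FreeAlg.g K k)) : ℝ) /
          (FreeAlg.deg (FreeAlg.g K k) : ℝ) = 1 / 2 + 2 / (2 * (k : ℝ) + 1) ∧
      (1 / 2 : ℝ) < (FreeAlg.deg (FreeAlg.comm (FreeAlg.f K k) (FreeAlg.g K k)) : ℝ) /
          (FreeAlg.deg (FreeAlg.g K k) : ℝ)) ∧
    Tendsto (fun k : ℕ =>
        (FreeAlg.deg (FreeAlg.comm (FreeAlg.f K k) (FreeAlg.g K k)) : ℝ) /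
          (FreeAlg.deg (FreeAlg.g K k) : ℝ)) atTop (𝓝 (1 / 2)) ∧
    ¬ FreeAlg.YuConjecture K (Fin 2) := by
  have hdeg : ∀ k : ℕ, 2 ≤ k →
      FreeAlg.deg (FreeAlg.f K k) = 6 * k + 3 ∧ FreeAlg.deg (FreeAlg.g K k) = 4 * k + 2 ∧
      FreeAlg.deg (FreeAlg.comm (FreeAlg.f K k) (FreeAlg.g K k)) = 2 * k + 5 := by
    intro k hk
    have hu := FreeAlg.u_ne_zero K k
    refine ⟨?_, ?_, ?_⟩
    · rw [(FreeAlg.hasTop_f K (by omega : 1 ≤ k)).deg_eq (pow_ne_zero _ hu)]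
      ring
    · rw [(FreeAlg.hasTop_g K (by omega : 1 ≤ k)).deg_eq (pow_ne_zero _ hu)]
      ring
    · rw [FreeAlg.comm_f_g]
      exact (FreeAlg.hasTop_fgComm K k).deg_eq (FreeAlg.fgComm_ne_zero K k)
  have hquot : ∀ k : ℕ, 2 ≤ k →
      (FreeAlg.deg (FreeAlg.comm (FreeAlg.f K k) (FreeAlg.g K k)) : ℝ) /
        (FreeAlg.deg (FreeAlg.g K k) : ℝ) = 1 / 2 + 2 / (2 * (k : ℝ) + 1) := by
    intro k hk
    obtain ⟨-, h₂, h₃⟩ := hdeg k hk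
    rw [h₂, h₃]
    push_cast
    have h₁ : (2 * (k : ℝ) + 1) ≠ 0 := by positivity
    have h₂ : (4 * (k : ℝ) + 2) ≠ 0 := by positivity
    field_simp
    ring
  have hdvd : ∀ k : ℕ, ¬ 6 * k + 3 ∣ 4 * k + 2 ∧ ¬ 4 * k + 2 ∣ 6 * k + 3 := by
    intro k
    constructor
    · intro h
      have := Nat.le_of_dvd (by omega) h
      omega
    · intro h
      have : 2 ∣ 6 * k + 3 := (Dvd.intro (2 * k + 1) (by ring)).trans h
      omega
  have hlead : ∀ k : ℕ, 2 ≤ k → FreeAlg.leading (FreeAlg.f K k) = FreeAlg.u K k ^ 3 ∧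
      FreeAlg.leading (FreeAlg.g K k) = FreeAlg.u K k ^ 2 := fun k hk =>
    ⟨(FreeAlg.hasTop_f K (by omega)).leading_eq (pow_ne_zero _ (FreeAlg.u_ne_zero K k)),
      (FreeAlg.hasTop_g K (by omega)).leading_eq (pow_ne_zero _ (FreeAlg.u_ne_zero K k))⟩
  refine ⟨fun k hk => ?_, ?_, fun hYu => ?_⟩
  · obtain ⟨h₁, h₂, h₃⟩ := hdeg k hk
    obtain ⟨l₁, l₂⟩ := hlead k hk
    refine ⟨FreeAlg.algIndep_f_g K k, FreeAlg.generatesCentralizer_f K (by omega),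
      FreeAlg.generatesCentralizer_g K (by omega), l₁, l₂, ?_, h₁, h₂, ?_, ?_, ?_, h₃, ?_, ?_,
      hquot k hk, ?_⟩
    · rw [l₁, l₂]
      exact FreeAlg.algDep_pow _ _ _
    · rw [h₁, h₂]
      exact (hdvd k).1
    · rw [h₁, h₂]
      exact (hdvd k).2
    · rw [FreeAlg.comm_f_g]
      exact FreeAlg.fgComm_ne_zero K k
    · rw [h₂, h₃]
      omega
    · rw [h₁, h₂]
      omega
    · rw [hquot k hk]
      have : (0 : ℝ) < 2 / (2 * (k : ℝ) + 1) := by positivity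
      linarith
  · have hlim : Tendsto (fun k : ℕ => (1 / 2 : ℝ) + 2 / (2 * (k : ℝ) + 1)) atTop (𝓝 (1 / 2)) := by
      have h₁ : Tendsto (fun k : ℕ => 2 * (k : ℝ) + 1) atTop atTop :=
        tendsto_atTop_add_const_right _ _
          (tendsto_natCast_atTop_atTop.const_mul_atTop (by norm_num))
      simpa using (h₁.const_div_atTop 2).const_add (1 / 2 : ℝ)
    refine hlim.congr' ?_
    filter_upwards [eventually_ge_atTop 2] with k hk
    exact (hquot k hk).symm
  · obtain ⟨h₁, h₂, h₃⟩ := hdeg 2 le_rfl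
    obtain ⟨l₁, l₂⟩ := hlead 2 le_rfl
    have := hYu (FreeAlg.f K 2) (FreeAlg.g K 2) (FreeAlg.algIndep_f_g K 2)
      (by rw [l₁, l₂]; exact FreeAlg.algDep_pow _ _ _)
      (FreeAlg.generatesCentralizer_f K (by omega)) (FreeAlg.generatesCentralizer_g K (by omega))
      (by rw [h₁, h₂]; exact (hdvd 2).1) (by rw [h₁, h₂]; exact (hdvd 2).2)
    rw [h₁, h₂, h₃] at this
    omega
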